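/- Let $\Gamma$ be a tropical curve, given by a model: a finite connected graph $G=(V,E)$ (loops and multiple edges allowed) without separating edges, edge lengths $\ell\colon E\to\mathbb{R}_{>0}$, and an orientation of each edge $e$ from $\mathrm{src}(e)$ to $\mathrm{dst}(e)$. Tropical chains: $C_{0,0}=\bigoplus_v A$, $C_{0,1}=\bigoplus_e A$, $C_{1,1}=\bigoplus_e A\cdot 1_e$ and $C_{1,0}=\bigoplus_v F_1(v)$ for $A=\mathbb{Z}$ or $\mathbb{R}$, where $1_e$ is the unit tangent vector of $e$ and $F_1(v)$ is generated by the vectors $1_e$, one for each end of an edge $e$ at $v$, modulo the single relation that the outgoing unit vectors $\pm 1_e$ at $v$ sum to $0$. The boundary is $\partial[e,w]=[\mathrm{dst}(e),w]-[\mathrm{src}(e),w]$, and $H_{p,q}(\Gamma,A)$ is the homology; in particular $H_{0,1}(\Gamma,A)=H_1(\Gamma,A)$. The monodromy operator $N\colon H_{0,1}(\Gamma,\mathbb{R})\to H_{1,0}(\Gamma,\mathbb{R})$ is induced by $$N([e,1])=[\mathrm{src}(e),o_e-\mathrm{src}(e)]-[\mathrm{dst}(e),o_e-\mathrm{dst}(e)]=\tfrac{\ell(e)}{2}\big([\mathrm{src}(e),1_e]+[\mathrm{dst}(e),1_e]\big),$$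 with $o_e$ the midpoint of $e$. The intermediate Jacobian is $\mathrm{JH}_{1,0}(\Gamma)=H_{1,0}(\Gamma,\mathbb{R})/N(H_{0,1}(\Gamma,\mathbb{Z}))$. A $0$-cycle $D$ on $\Gamma$ (a finite integral combination of points) is homologically trivial if, after subdividing the model so that the support of $D$ consists of vertices, its class in $H_{0,0}(\Gamma,\mathbb{Z})$ vanishes; then $\mathrm{AJ}(D)\in\mathrm{JH}_{1,0}(\Gamma)$ is the class of $N(\gamma)$ for any integral chain $\gamma\in C_{0,1}$ of the subdivision with $\partial\gamma=D$. Let $\Omega$ be the real vector space of harmonic $1$-forms on $\Gamma$ (constant $\omega=\omega(1_e)\,dt$ on each edge $e$, with $\sum_{\mathrm{src}(e)=v}\omega(1_e)=\sum_{\mathrm{dst}(e)=v}\omega(1_e)$ at each vertex $v$), and let $\mathrm{ev}_\gamma=\big(\omega\mapsto\int_\gamma\omega\big)\in\Omega^\vee$. The Jacobian is $\mathrm{Jac}(\Gamma)=\Omega^\vee/\mathrm{ev}(H_1(\Gamma,\mathbb{Z}))$, and the classical Abel–Jacobi map sends a divisor $\sum a_ix_i$ of degree zero to the class of $\omega\mapsto\sum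 a_i\int_{\eta_i}\omega$, where $\eta_i$ is any path from a fixed base point to $x_i$. Theorem. (1) The homologically trivial $0$-cycles on $\Gamma$ are exactly the divisors of degree zero. $H_{1,0}$, $\mathrm{JH}_{1,0}$, homological triviality and $\mathrm{AJ}$ do not depend on the subdivision of the model used to compute them. (2) There is a (canonical) linear isomorphism $\Omega^\vee\cong H_{1,0}(\Gamma,\mathbb{R})$ that sends, for each edge $e$, the functional $\omega\mapsto\omega(1_e)=\mathrm{ev}_e(\omega)/\ell(e)$ to the class of $[v,1_e]$ for both end vertices $v$ of $e$. Under it, monodromy is integration: $N(\gamma)=\mathrm{ev}_\gamma$ for all $\gamma\in H_{0,1}(\Gamma,\mathbb{R})=H_1(\Gamma,\mathbb{R})$. (3) This isomorphism induces an isomorphism $\mathrm{Jac}(\Gamma)\cong\mathrm{JH}_{1,0}(\Gamma)$, under which the classical Abel–Jacobi map on divisors of degree zero, for any base point and any choice of paths, agrees with $\mathrm{AJ}$. -/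

import Mathlib

universe u

noncomputable section

/-- A finite oriented graph (loops and multiple edges allowed) with positive edge lengths: a model
`(G, ℓ)` of a compact metric graph together with an orientation of the edges. -/
structure MetricGraph where
  V : Type u
  E : Type u
  [fintypeV : Fintype V]
  [fintypeE : Fintype E]
  src : E → V
  dst : E → V
  len : E → ℝ
  len_pos : ∀ e, 0 < len e

attribute [instance] MetricGraph.fintypeV MetricGraph.fintypeE

namespace MetricGraph

/-! ### Points, paths, connectedness, divisors -/

section Points

variable (Γ : MetricGraph.{u})

/-- The points of the metric graph: vertices, and interior points of edges, the latter given by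
their distance to the source of the edge. -/
abbrev Point : Type u := Γ.V ⊕ (Σ e : Γ.E, Set.Ioo (0 : ℝ) (Γ.len e))

open scoped Classical in
/-- The point at distance `t` from the source of the closed edge `e`. -/
def pt (e : Γ.E) (t : Set.Icc (0 : ℝ) (Γ.len e)) : Γ.Point :=
  if h0 : t.1 = 0 then Sum.inl (Γ.src e)
  else if h1 : t.1 = Γ.len e then Sum.inl (Γ.dst e)
  else Sum.inr ⟨e, t.1, lt_of_le_of_ne t.2.1 (Ne.symm h0), lt_of_le_of_ne t.2.2 h1⟩

/-- Piecewise affine paths in the metric graph. `cons e a b p` first runs through the edge `e`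
monotonically from parameter `a` to parameter `b` (forwards or backwards) and then along `p`. -/
inductive Path : Γ.Point → Γ.Point → Type u
  | nil (x : Γ.Point) : Path x x
  | cons (e : Γ.E) (a b : Set.Icc (0 : ℝ) (Γ.len e)) {y : Γ.Point} (p : Path (Γ.pt e b) y) :
      Path (Γ.pt e a) y

/-- The set of edges used by a path. -/
def Path.edges {Γ : MetricGraph.{u}} : {x y : Γ.Point} → Γ.Path x y → Set Γ.E
  | _, _, .nil _ => ∅
  | _, _, .cons e _ _ p => insert e p.edges

/-- The metric graph is nonempty and path connected. -/
def Connected : Prop := Nonempty Γ.V ∧ ∀ x y : Γ.Point, Nonempty (Γ.Path x y)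

/-- No edge is separating: the end points of each edge `e` are joined by a path avoiding `e`. -/
def NoSeparatingEdges : Prop :=
  ∀ e : Γ.E, ∃ p : Γ.Path (Sum.inl (Γ.src e)) (Sum.inl (Γ.dst e)), e ∉ p.edges

/-- Divisors: finite integral combinations of points. -/
abbrev Div : Type u := Γ.Point →₀ ℤ

/-- The degree of a divisor. -/
def degree : Γ.Div →+ ℤ := Finsupp.liftAddHom fun _ => AddMonoidHom.id ℤ

/-- Divisors of degree zero. -/
def Div0 : AddSubgroup Γ.Div := Γ.degree.ker

end Points

/-! ### Tropical homology of a one-dimensional polyhedral structure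

The cells are the vertices and the edges. The cosheaf `F_0` is constant, `F_1(e) = R · 1_e` with
`1_e` the unit tangent vector of `e`, and `F_1(v)` is generated by the vectors `1_e` of the edges
at `v` (a loop at `v` contributing once for each of its two ends) subject to the relation that the
outgoing unit tangent vectors at `v` add up to zero. -/

section Homology

variable (Γ : MetricGraph.{u}) (R : Type) [CommRing R]

/-- The end of the edge `h.1` at its source (`h.2 = false`) or at its target (`h.2 = true`). -/
def root (h : Γ.E × Bool) : Γ.V := if h.2 then Γ.dst h.1 else Γ.src h.1

/-- The sign of an edge at one of its ends: `1` at the source and `-1` at the target, so that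
`sgn s • 1_e` is the unit tangent vector pointing into the edge. -/
def sgn (s : Bool) : R := if s then -1 else 1

/-- The ends of edges at the vertex `v`. -/
abbrev EndAt (v : Γ.V) : Type u := {h : Γ.E × Bool // Γ.root h = v}

instance (v : Γ.V) : Fintype (Γ.EndAt v) := Fintype.ofFinite _

/-- The element `∑ sgn(e, v) 1_e` of `⨁_{e ∋ v} F_1(e)`. -/
def balancing (v : Γ.V) : Γ.EndAt v → R := fun h => sgn R h.1.2

/-- `F_1(v) = (⨁_{e ∋ v} F_1(e)) / ⟨∑ sgn(e, v) 1_e⟩`. -/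
abbrev F1 (v : Γ.V) : Type u := (Γ.EndAt v → R) ⧸ Submodule.span R {Γ.balancing R v}

/-- `C_{0,0} = ⨁_v R`. -/
abbrev C00 : Type u := Γ.V → R

/-- `C_{0,1} = ⨁_e R`. -/
abbrev C01 : Type u := Γ.E → R

/-- `C_{1,1} = ⨁_e R · 1_e`. -/
abbrev C11 : Type u := Γ.E → R

/-- `C_{1,0} = ⨁_v F_1(v)`. -/
abbrev C10 : Type u := ∀ v : Γ.V, Γ.F1 R v

open scoped Classical in
/-- The `(1,0)`-chain `[v, 1_e]`, where `v` is the vertex at the end `h` of the edge `e`. -/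
def endChain (h : Γ.E × Bool) : Γ.C10 R :=
  Pi.single (Γ.root h) (Submodule.Quotient.mk (Pi.single (⟨h, rfl⟩ : Γ.EndAt (Γ.root h)) 1))

open scoped Classical in
/-- `∂ : C_{0,1} → C_{0,0}`, `[e, 1] ↦ [dst e, 1] - [src e, 1]`. -/
def bdry0 : Γ.C01 R →ₗ[R] Γ.C00 R :=
  Fintype.linearCombination R fun e => (Pi.single (Γ.dst e) 1 - Pi.single (Γ.src e) 1 : Γ.V → R)

/-- `∂ : C_{1,1} → C_{1,0}`, `[e, 1_e] ↦ [dst e, 1_e] - [src e, 1_e]`. -/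
def bdry1 : Γ.C11 R →ₗ[R] Γ.C10 R :=
  Fintype.linearCombination R fun e => Γ.endChain R (e, true) - Γ.endChain R (e, false)

/-- `H_{0,0}(Γ, R)`. -/
abbrev H00 : Type u := Γ.C00 R ⧸ LinearMap.range (Γ.bdry0 R)

/-- `H_{0,1}(Γ, R)`. As `F_0` is constant, this is also `H_1(Γ, R)`. -/
abbrev H01 : Type u := LinearMap.ker (Γ.bdry0 R)

/-- `H_{1,0}(Γ, R)`. -/
abbrev H10 : Type u := Γ.C10 R ⧸ LinearMap.range (Γ.bdry1 R)

/-- The class of `[v, 1_e]` in `H_{1,0}`, where `v` is the vertex at the end `h` of `e`. -/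
def endClass (h : Γ.E × Bool) : Γ.H10 R := Submodule.Quotient.mk (Γ.endChain R h)

end Homology

/-! ### Monodromy, the intermediate Jacobian, and the Abel–Jacobi map of a model -/

section Monodromy

variable (Γ : MetricGraph.{u})

/-- The vector `o_e - o_v` as a multiple of `1_e`, where `o_e` is the midpoint of `e` and
`o_v = v` is the end vertex `h` of `e`. -/
def markingVector (h : Γ.E × Bool) : ℝ :=
  if h.2 then Γ.len h.1 / 2 - Γ.len h.1 else Γ.len h.1 / 2 - 0

/-- The monodromy operator on chains, `N([e, 1]) = ∑_{v ≺ e} sgn(e, v) [v, o_e - o_v]`. -/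
def monodromyChain : Γ.C01 ℝ →ₗ[ℝ] Γ.C10 ℝ :=
  Fintype.linearCombination ℝ fun e =>
    ∑ s : Bool, (sgn ℝ s : ℝ) • (Γ.markingVector (e, s) • Γ.endChain ℝ (e, s))

/-- The monodromy operator `N : C_{0,1} → C_{1,0} / B_{1,0} = H_{1,0}`. -/
def monodromyMod : Γ.C01 ℝ →ₗ[ℝ] Γ.H10 ℝ :=
  (LinearMap.range (Γ.bdry1 ℝ)).mkQ ∘ₗ Γ.monodromyChain

/-- The monodromy operator `N : H_{0,1}(Γ, ℝ) → H_{1,0}(Γ, ℝ)`. -/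
def monodromy : Γ.H01 ℝ →ₗ[ℝ] Γ.H10 ℝ := Γ.monodromyMod ∘ₗ (LinearMap.ker (Γ.bdry0 ℝ)).subtype

/-- The inclusion of integral into real `(0,1)`-chains. -/
def intC01 : Γ.C01 ℤ →+ Γ.C01 ℝ where
  toFun γ := fun e => (γ e : ℝ)
  map_zero' := by ext; simp
  map_add' := by intros; ext; simp

lemma bdry0_apply (R : Type) [CommRing R] (γ : Γ.C01 R) (v : Γ.V) [DecidableEq Γ.V] :
    Γ.bdry0 R γ v =
      ∑ e, γ e * ((if v = Γ.dst e then 1 else 0) - (if v = Γ.src e then 1 else 0)) := by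
  simp only [bdry0, Fintype.linearCombination_apply, Finset.sum_apply, Pi.smul_apply,
    Pi.sub_apply, Pi.single_apply, smul_eq_mul]
  refine Finset.sum_congr rfl fun e _ => ?_
  congr

lemma intC01_mem {γ : Γ.C01 ℤ} (h : γ ∈ LinearMap.ker (Γ.bdry0 ℤ)) :
    Γ.intC01 γ ∈ LinearMap.ker (Γ.bdry0 ℝ) := by
  classical
  rw [LinearMap.mem_ker] at h ⊢
  ext v
  have h1 := congrFun h v
  rw [bdry0_apply] at h1 ⊢
  have h2 := congrArg (Int.cast : ℤ → ℝ) h1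
  push_cast at h2
  simpa [intC01] using h2

/-- The map `H_{0,1}(Γ, ℤ) → H_{0,1}(Γ, ℝ)`. -/
def intH01 : Γ.H01 ℤ →+ Γ.H01 ℝ :=
  (Γ.intC01.comp (LinearMap.ker (Γ.bdry0 ℤ)).subtype.toAddMonoidHom).codRestrict
    (LinearMap.ker (Γ.bdry0 ℝ)) fun γ => Γ.intC01_mem γ.2

/-- `L_{1,0}`, the image of `N : H_{0,1}(Γ, ℤ) → H_{1,0}(Γ, ℝ)`. -/
def L10 : AddSubgroup (Γ.H10 ℝ) := (Γ.monodromy.toAddMonoidHom.comp Γ.intH01).range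

/-- The intermediate Jacobian `JH_{1,0} = H_{1,0}(Γ, ℝ) / L_{1,0}`. -/
abbrev JH10 : Type u := Γ.H10 ℝ ⧸ Γ.L10

/-- The cycle class map on the 0-cycles that are supported on the vertices. -/
def cl : (Γ.V → ℤ) →ₗ[ℤ] Γ.H00 ℤ := (LinearMap.range (Γ.bdry0 ℤ)).mkQ

/-- The class of `N(γ)` in `JH_{1,0}`, for an integral `(0,1)`-chain `γ`. -/
def psi : Γ.C01 ℤ →+ Γ.JH10 :=
  (QuotientAddGroup.mk' Γ.L10).comp (Γ.monodromyMod.toAddMonoidHom.comp Γ.intC01)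

lemma psi_ker : (Γ.bdry0 ℤ).toAddMonoidHom.ker ≤ Γ.psi.ker := by
  intro γ hγ
  rw [AddMonoidHom.mem_ker]
  refine (QuotientAddGroup.eq_zero_iff _).2 ?_
  exact ⟨⟨γ, hγ⟩, rfl⟩

lemma mem_range_of_cl {α : Γ.V → ℤ} (h : α ∈ LinearMap.ker Γ.cl) :
    α ∈ (Γ.bdry0 ℤ).toAddMonoidHom.range := by
  rw [cl, Submodule.ker_mkQ] at h
  exact h

/-- The Abel–Jacobi map of a model on homologically trivial 0-cycles supported on the vertices:
`α ↦ [N(γ)]` for any integral chain `γ` with `∂ γ = α`. -/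
def abelJacobiModel : LinearMap.ker Γ.cl →+ Γ.JH10 :=
  ((QuotientAddGroup.lift _ Γ.psi Γ.psi_ker).comp
    (QuotientAddGroup.quotientKerEquivRange (Γ.bdry0 ℤ).toAddMonoidHom).symm.toAddMonoidHom).comp
    ((LinearMap.ker Γ.cl).subtype.toAddMonoidHom.codRestrict
      (Γ.bdry0 ℤ).toAddMonoidHom.range fun α => Γ.mem_range_of_cl α.2)

end Monodromy

/-! ### Harmonic forms, the Jacobian, and the classical Abel–Jacobi map -/

section Jacobian

variable (Γ : MetricGraph.{u})

open scoped Classical in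
/-- Harmonic 1-forms. The form `ω` is `ω e • dt` on the edge `e`, with `t` the distance to the
source. -/
def Omega : Submodule ℝ (Γ.E → ℝ) where
  carrier := {ω | ∀ v, ∑ e with Γ.src e = v, ω e = ∑ e with Γ.dst e = v, ω e}
  zero_mem' := by simp
  add_mem' := by
    intro a b ha hb v
    simp only [Pi.add_apply, Finset.sum_add_distrib, ha v, hb v]
  smul_mem' := by
    intro c a ha v
    simp only [Pi.smul_apply, smul_eq_mul, ← Finset.mul_sum, ha v]

/-- The functional `ω ↦ ω(1_e)` on harmonic forms. -/
def tangent (e : Γ.E) : Module.Dual ℝ Γ.Omega := LinearMap.proj e ∘ₗ Γ.Omega.subtype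

/-- Integration of harmonic forms over chains, `ev (∑ c_e e) = (ω ↦ ∑ c_e ∫_e ω)`. -/
def ev : Γ.C01 ℝ →ₗ[ℝ] Module.Dual ℝ Γ.Omega :=
  Fintype.linearCombination ℝ fun e => Γ.len e • Γ.tangent e

/-- The lattice of periods: the image of `H_1(Γ, ℤ)` under integration. -/
def periods : AddSubgroup (Module.Dual ℝ Γ.Omega) :=
  ((Γ.ev ∘ₗ (LinearMap.ker (Γ.bdry0 ℝ)).subtype).toAddMonoidHom.comp Γ.intH01).range

/-- The Jacobian `Ω^∨ / H_1(Γ, ℤ)`. -/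
abbrev Jac : Type u := Module.Dual ℝ Γ.Omega ⧸ Γ.periods

/-- Integration of harmonic forms along a path. -/
def Path.integral {Γ : MetricGraph.{u}} :
    {x y : Γ.Point} → Γ.Path x y → Module.Dual ℝ Γ.Omega
  | _, _, .nil _ => 0
  | _, _, .cons e a b p => (b.1 - a.1) • Γ.tangent e + p.integral

/-- The classical Abel–Jacobi map on divisors of degree zero, for a base point `x₀` and paths
`η x` from `x₀` to `x`: the divisor `∑ a_i x_i` is sent to the class of `ω ↦ ∑ a_i ∫_{η x_i} ω`. -/
def abelJacobiClassical {x₀ : Γ.Point} (η : ∀ x, Γ.Path x₀ x) : Γ.Div0 →+ Γ.Jac :=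
  (Finsupp.liftAddHom fun x =>
    zmultiplesHom Γ.Jac (QuotientAddGroup.mk (η x).integral)).comp Γ.Div0.subtype

end Jacobian

/-! ### Subdivisions -/

/-- A subdivision of the edges: `n e` new vertices in the interior of `e`, and the distances
`0 = pos e 0 < pos e 1 < ⋯ < pos e (n e + 1) = len e` of all vertices on `e` to its source. -/
structure Subdivision (Γ : MetricGraph.{u}) where
  n : Γ.E → ℕ
  pos : ∀ e, Fin (n e + 2) → ℝ
  strictMono : ∀ e, StrictMono (pos e)
  pos_zero : ∀ e, pos e 0 = 0
  pos_last : ∀ e, pos e (Fin.last _) = Γ.len e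

namespace Subdivision

variable {Γ : MetricGraph.{u}} (P : Subdivision Γ)

/-- The vertices along the closed edge `e`. -/
def vert (e : Γ.E) : Fin (P.n e + 2) → Γ.V ⊕ (Σ e : Γ.E, Fin (P.n e)) :=
  Fin.cases (Sum.inl (Γ.src e)) (Fin.lastCases (Sum.inl (Γ.dst e)) fun i => Sum.inr ⟨e, i⟩)

/-- The subdivided model. -/
def graph : MetricGraph.{u} where
  V := Γ.V ⊕ (Σ e : Γ.E, Fin (P.n e))
  E := Σ e : Γ.E, Fin (P.n e + 1)
  src i := P.vert i.1 i.2.castSucc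
  dst i := P.vert i.1 i.2.succ
  len i := P.pos i.1 i.2.succ - P.pos i.1 i.2.castSucc
  len_pos i := sub_pos.2 (P.strictMono i.1 i.2.castSucc_lt_succ)

/-- The point of `Γ` given by a vertex of the subdivision. -/
def point : P.graph.V → Γ.Point
  | Sum.inl v => Sum.inl v
  | Sum.inr ⟨e, i⟩ => Sum.inr ⟨e, P.pos e i.castSucc.succ,
      by rw [← P.pos_zero e]; exact P.strictMono e (Fin.succ_pos _),
      by rw [← P.pos_last e]; exact P.strictMono e
          (by rw [← Fin.succ_last]; exact Fin.succ_lt_succ_iff.2 (Fin.castSucc_lt_last i))⟩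

/-- The divisor `D` is supported on the vertices of the subdivision. -/
def Supports (D : Γ.Div) : Prop := ∀ x ∈ D.support, x ∈ Set.range P.point

/-- A divisor as a 0-chain on the vertices of the subdivision. -/
def restrict (D : Γ.Div) : P.graph.V → ℤ := fun v => D (P.point v)

/-- The class in `H_{1,0}(Γ, ℝ)` of the unit tangent vector of the edge containing an edge of the
subdivision. -/
def parentClass (h : P.graph.E × Bool) : Γ.H10 ℝ := Γ.endClass ℝ (Sigma.fst h.1, false)

lemma endClass_eq (e : Γ.E) : Γ.endClass ℝ (e, true) = Γ.endClass ℝ (e, false) := by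
  classical
  refine (Submodule.Quotient.eq _).2 ⟨Pi.single e 1, ?_⟩
  rw [bdry1, Fintype.linearCombination_apply_single, one_smul]

lemma sum_endAt {G : MetricGraph.{u}} {M : Type u} [AddCommGroup M] [DecidableEq G.V] (v : G.V)
    (f : G.E × Bool → M) :
    ∑ h : G.EndAt v, f h.1 =
      ∑ e, ((if v = G.dst e then f (e, true) else 0) + if v = G.src e then f (e, false) else 0) := by
  classical
  have h1 : ∑ h : G.EndAt v, f h.1 = ∑ h : G.E × Bool, if G.root h = v then f h else 0 := by
    rw [← Finset.sum_filter]
    exact (Finset.sum_subtype _ (by simp) f).symm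
  rw [h1, Fintype.sum_prod_type]
  refine Finset.sum_congr rfl fun e _ => ?_
  simp [root, eq_comm]

lemma sum_telescope {M : Type*} [AddCommGroup M] {n : ℕ} (f : Fin (n + 2) → M) :
    ∑ i : Fin (n + 1), (f i.succ - f i.castSucc) = f (Fin.last _) - f 0 := by
  rw [Finset.sum_sub_distrib]
  have h1 := Fin.sum_univ_succ f
  have h2 := Fin.sum_univ_castSucc f
  rw [h1] at h2
  rw [sub_eq_sub_iff_add_eq_add, add_comm, h2, add_comm]

lemma vert_zero (e : Γ.E) : P.vert e 0 = Sum.inl (Γ.src e) := rfl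

lemma vert_last (e : Γ.E) : P.vert e (Fin.last _) = Sum.inl (Γ.dst e) := by
  rw [← Fin.succ_last, vert, Fin.cases_succ, Fin.lastCases_last]

lemma vert_inner (e : Γ.E) (i : Fin (P.n e)) :
    P.vert e i.castSucc.succ = Sum.inr ⟨e, i⟩ := by
  simp [vert]

lemma sum_graph {M : Type u} [AddCommGroup M] (f : P.graph.E → M) :
    ∑ i, f i = ∑ e : Γ.E, ∑ i : Fin (P.n e + 1), f ⟨e, i⟩ :=
  Fintype.sum_sigma (ι := Γ.E) (α := fun e => Fin (P.n e + 1)) f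

lemma sum_graph' (f : P.graph.E → ℤ) :
    ∑ i, f i = ∑ e : Γ.E, ∑ i : Fin (P.n e + 1), f ⟨e, i⟩ :=
  Fintype.sum_sigma (ι := Γ.E) (α := fun e => Fin (P.n e + 1)) f

lemma balancing_base (v : Γ.V) :
    ∑ h : Γ.EndAt v, (sgn ℝ h.1.2 : ℝ) • Γ.endClass ℝ h.1 = 0 := by
  classical
  have h0 : (Submodule.Quotient.mk (Γ.balancing ℝ v) : Γ.F1 ℝ v) = 0 :=
    (Submodule.Quotient.mk_eq_zero _).2 (Submodule.mem_span_singleton_self _)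
  have h1 : ∀ h : Γ.EndAt v, Γ.endChain ℝ h.1 =
      Pi.single v (Submodule.Quotient.mk (Pi.single h (1 : ℝ)) : Γ.F1 ℝ v) := by
    rintro ⟨h, rfl⟩
    simp only [endChain]
  have h2 : ∑ h : Γ.EndAt v, (sgn ℝ h.1.2 : ℝ) • Γ.endChain ℝ h.1 = 0 := by
    simp only [h1]
    have h3' : Γ.balancing ℝ v = ∑ h : Γ.EndAt v, (sgn ℝ h.1.2 : ℝ) • Pi.single h (1 : ℝ) := by
      ext k
      simp [balancing, Finset.sum_apply, Pi.single_apply]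
    have h0' : ∑ h : Γ.EndAt v, (sgn ℝ h.1.2 : ℝ) •
        (Submodule.span ℝ {Γ.balancing ℝ v}).mkQ (Pi.single h (1 : ℝ)) = 0 := by
      refine Eq.trans ?_ h0
      refine Eq.trans ?_ (congrArg (Submodule.span ℝ {Γ.balancing ℝ v}).mkQ h3').symm
      rw [map_sum]
      simp only [map_smul]
    have h4 := congrArg (LinearMap.single ℝ (fun v => Γ.F1 ℝ v) v) h0'
    rw [map_sum, map_zero] at h4
    simp only [map_smul] at h4
    exact h4
  have h5 := congrArg (LinearMap.range (Γ.bdry1 ℝ)).mkQ h2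
  rw [map_sum, map_zero] at h5
  simp only [map_smul] at h5
  exact h5

lemma balancing_graph (v : P.graph.V) :
    ∑ h : P.graph.EndAt v, (sgn ℝ h.1.2 : ℝ) • P.parentClass h.1 = 0 := by
  classical
  rw [sum_endAt v (fun h => (sgn ℝ h.2 : ℝ) • P.parentClass h), sum_graph]
  have key : ∀ e : Γ.E, (∑ i : Fin (P.n e + 1),
      ((if v = P.graph.dst ⟨e, i⟩ then
          (sgn ℝ true : ℝ) • P.parentClass ((⟨e, i⟩ : P.graph.E), true) else 0) +
        if v = P.graph.src ⟨e, i⟩ then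
          (sgn ℝ false : ℝ) • P.parentClass ((⟨e, i⟩ : P.graph.E), false) else 0)) =
      (if v = Sum.inl (Γ.dst e) then (sgn ℝ true : ℝ) • Γ.endClass ℝ (e, true) else 0) +
        if v = Sum.inl (Γ.src e) then (sgn ℝ false : ℝ) • Γ.endClass ℝ (e, false) else 0 := by
    intro e
    have := sum_telescope (fun j : Fin (P.n e + 2) =>
      if v = P.vert e j then - Γ.endClass ℝ (e, false) else 0)
    rw [vert_zero, vert_last] at this
    rw [endClass_eq]
    simp only [sgn, Bool.false_eq_true, if_true, if_false, neg_smul, one_smul]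
    convert this using 1
    · refine Finset.sum_congr rfl fun i _ => ?_
      change (if v = P.vert e i.succ then _ else _) + (if v = P.vert e i.castSucc then _ else _) = _
      simp only [parentClass]
      split_ifs <;> simp
    · split_ifs <;> simp
  rw [Finset.sum_congr rfl fun e _ => key e]
  rcases v with v | ⟨e, i⟩
  · have h := balancing_base (Γ := Γ) v
    rw [sum_endAt v (fun h => (sgn ℝ h.2 : ℝ) • Γ.endClass ℝ h)] at h
    refine Eq.trans (Finset.sum_congr rfl fun e _ => ?_) h
    have hi : ∀ w : Γ.V, ((Sum.inl v : P.graph.V) = Sum.inl w) ↔ v = w :=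
      fun w => Sum.inl.injEq v w ▸ Iff.rfl
    exact congrArg₂ (· + ·) (if_congr (hi _) rfl rfl) (if_congr (hi _) rfl rfl)
  · refine Finset.sum_eq_zero fun e _ => ?_
    exact (congrArg₂ (· + ·) (if_neg (fun h => by cases h))
      (if_neg (fun h => by cases h))).trans (add_zero _)

/-- The map `F_1(v) → H_{1,0}(Γ, ℝ)` that sends the unit tangent vector of an edge of the
subdivision to the class of the unit tangent vector of the edge of `Γ` containing it. -/
def collapseF1 (v : P.graph.V) : P.graph.F1 ℝ v →ₗ[ℝ] Γ.H10 ℝ :=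
  Submodule.liftQ _
    (Fintype.linearCombination ℝ fun h : P.graph.EndAt v => P.parentClass h.1) (by
      rw [Submodule.span_singleton_le_iff_mem, LinearMap.mem_ker,
        Fintype.linearCombination_apply]
      exact P.balancing_graph v)

/-- The induced map on chains. -/
def collapseC10 : P.graph.C10 ℝ →ₗ[ℝ] Γ.H10 ℝ := ∑ v, P.collapseF1 v ∘ₗ LinearMap.proj v

lemma collapseC10_endChain (h : P.graph.E × Bool) :
    P.collapseC10 (P.graph.endChain ℝ h) = P.parentClass h := by
  classical
  simp only [collapseC10, LinearMap.sum_apply, LinearMap.comp_apply, LinearMap.proj_apply]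
  rw [Finset.sum_eq_single (P.graph.root h)]
  · have : P.graph.endChain ℝ h (P.graph.root h) = Submodule.Quotient.mk
        (Pi.single (⟨h, rfl⟩ : P.graph.EndAt (P.graph.root h)) 1) := by
      rw [endChain, Pi.single_eq_same]
    rw [this, collapseF1, Submodule.liftQ_apply]
    rw [Fintype.linearCombination_apply_single, one_smul]
  · intro v _ hv
    rw [endChain, Pi.single_eq_of_ne hv, map_zero]
  · simp

/-- The identification of `H_{1,0}` of the subdivided model with `H_{1,0}(Γ, ℝ)`; it sends the
class of `[v, 1_{e'}]` to the class of `1_e`, where `e` is the edge of `Γ` containing `e'`. -/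
def collapse : P.graph.H10 ℝ →ₗ[ℝ] Γ.H10 ℝ :=
  Submodule.liftQ _ P.collapseC10 (by
    classical
    rintro _ ⟨c, rfl⟩
    have hb : P.graph.bdry1 ℝ c = ∑ i, c i •
        (P.graph.endChain ℝ (i, true) - P.graph.endChain ℝ (i, false)) :=
      Fintype.linearCombination_apply ..
    rw [LinearMap.mem_ker, hb, map_sum]
    refine Finset.sum_eq_zero fun i _ => ?_
    rw [map_smul, map_sub, collapseC10_endChain, collapseC10_endChain]
    simp [parentClass])

lemma collapse_monodromyMod (γ : P.graph.C01 ℝ) :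
    P.collapse (P.graph.monodromyMod γ) =
      ∑ i, (γ i * P.graph.len i) • P.parentClass (i, false) := by
  change P.collapseC10 (P.graph.monodromyChain γ) = _
  rw [monodromyChain, Fintype.linearCombination_apply, map_sum]
  refine Finset.sum_congr rfl fun i _ => ?_
  simp only [Fintype.sum_bool, map_smul, map_add, collapseC10_endChain, sgn, markingVector]
  have : P.parentClass (i, true) = P.parentClass (i, false) := rfl
  rw [this]
  simp only [if_true, Bool.false_eq_true, if_false, smul_smul, ← add_smul]
  congr 1
  ring

lemma monodromyMod_eq (γ : Γ.C01 ℝ) :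
    Γ.monodromyMod γ = ∑ e, (γ e * Γ.len e) • Γ.endClass ℝ (e, false) := by
  change (LinearMap.range (Γ.bdry1 ℝ)).mkQ (Γ.monodromyChain γ) = _
  rw [monodromyChain, Fintype.linearCombination_apply, map_sum]
  refine Finset.sum_congr rfl fun i _ => ?_
  simp only [Fintype.sum_bool, map_smul, map_add, sgn, markingVector]
  change γ i • ((_ : ℝ) • ((_ : ℝ) • Γ.endClass ℝ (i, true)) +
    (_ : ℝ) • ((_ : ℝ) • Γ.endClass ℝ (i, false))) = _
  rw [endClass_eq]
  simp only [if_true, Bool.false_eq_true, if_false, smul_smul, ← add_smul]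
  congr 1
  ring

lemma cycle_eq {G : MetricGraph.{u}} {γ : G.C01 ℤ} (h : G.bdry0 ℤ γ = 0) (v : G.V) {a b : G.E}
    (hb : ∀ k, v = G.dst k ↔ k = b) (ha : ∀ k, v = G.src k ↔ k = a) : γ a = γ b := by
  classical
  have h1 := congrFun h v
  rw [bdry0_apply] at h1
  simp only [hb, ha, mul_sub, mul_ite, mul_one, mul_zero, Finset.sum_sub_distrib,
    Finset.sum_ite_eq', Finset.mem_univ, if_true] at h1
  exact (sub_eq_zero.1 h1).symm

/-- Integral cycles on the subdivision are constant along the edges of `Γ`. -/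
lemma cycle_const {γ : P.graph.C01 ℤ} (h : γ ∈ LinearMap.ker (P.graph.bdry0 ℤ)) (e : Γ.E)
    (i : Fin (P.n e + 1)) : γ ⟨e, i⟩ = γ ⟨e, 0⟩ := by
  classical
  induction i using Fin.induction with
  | zero => rfl
  | succ i ih =>
    rw [← ih]
    have h2 : ∀ (e' : Γ.E) (j : Fin (P.n e' + 2)),
        (Sum.inr ⟨e, i⟩ = P.vert e' j) ↔ (e' = e ∧ j.1 = i.1 + 1) := by
      intro e' j
      constructor
      · intro hh
        induction j using Fin.cases with
        | zero => simp [vert] at hh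
        | succ j =>
          induction j using Fin.lastCases with
          | last => rw [Fin.succ_last, vert_last] at hh; cases hh
          | cast j =>
            rw [vert_inner] at hh
            obtain ⟨rfl, hj⟩ := Sigma.mk.inj_iff.1 (Sum.inr.inj hh)
            simp [← eq_of_heq hj]
      · rintro ⟨rfl, hj⟩
        have : j = i.castSucc.succ := by ext; simpa using hj
        rw [this, vert_inner]
    have h3 : ∀ k : P.graph.E,
        (Sum.inr ⟨e, i⟩ = P.graph.dst k ↔ k = (⟨e, i.castSucc⟩ : P.graph.E)) ∧
        (Sum.inr ⟨e, i⟩ = P.graph.src k ↔ k = (⟨e, i.succ⟩ : P.graph.E)) := by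
      rintro ⟨e', j⟩
      have hd : (Sum.inr ⟨e, i⟩ = P.graph.dst ⟨e', j⟩) ↔
          ((⟨e', j⟩ : P.graph.E) = ⟨e, i.castSucc⟩) := by
        refine (h2 e' j.succ).trans ?_
        constructor
        · rintro ⟨rfl, hj⟩
          congr 1
          ext
          simpa using hj
        · intro hh
          obtain ⟨rfl, hj⟩ := Sigma.mk.inj_iff.1 hh
          simp [eq_of_heq hj]
      have hs : (Sum.inr ⟨e, i⟩ = P.graph.src ⟨e', j⟩) ↔
          ((⟨e', j⟩ : P.graph.E) = ⟨e, i.succ⟩) := by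
        refine (h2 e' j.castSucc).trans ?_
        constructor
        · rintro ⟨rfl, hj⟩
          congr 1
          ext
          simpa using hj
        · intro hh
          obtain ⟨rfl, hj⟩ := Sigma.mk.inj_iff.1 hh
          simp [eq_of_heq hj]
      exact ⟨hd, hs⟩
    exact cycle_eq (LinearMap.mem_ker.1 h) (Sum.inr ⟨e, i⟩) (fun k => (h3 k).1) fun k => (h3 k).2

lemma collapse_L10 : P.graph.L10 ≤ Γ.L10.comap P.collapse.toAddMonoidHom := by
  classical
  rintro _ ⟨⟨γ, hγ⟩, rfl⟩
  have hc := P.cycle_const hγ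
  have hg : (fun e => γ ⟨e, 0⟩ : Γ.C01 ℤ) ∈ LinearMap.ker (Γ.bdry0 ℤ) := by
    rw [LinearMap.mem_ker]
    ext v
    have h1 := (bdry0_apply P.graph ℤ γ (Sum.inl v)).symm.trans
      (congrFun (LinearMap.mem_ker.1 hγ) (Sum.inl v))
    rw [bdry0_apply]
    rw [sum_graph'] at h1
    refine Eq.trans (Finset.sum_congr rfl fun e _ => ?_) h1
    simp only [hc e, ← Finset.mul_sum]
    congr 1
    have := sum_telescope (fun j : Fin (P.n e + 2) =>
      if Sum.inl v = P.vert e j then (1 : ℤ) else 0)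
    rw [vert_zero, vert_last] at this
    simp only [Sum.inl.injEq] at this
    refine this.symm.trans (Finset.sum_congr rfl fun i _ => ?_)
    exact congrArg₂ (· - ·) (if_congr Iff.rfl rfl rfl) (if_congr Iff.rfl rfl rfl)
  refine ⟨⟨_, hg⟩, ?_⟩
  change Γ.monodromyMod (Γ.intC01 _) = P.collapse (P.graph.monodromyMod (P.graph.intC01 γ))
  rw [collapse_monodromyMod, monodromyMod_eq, sum_graph]
  refine Finset.sum_congr rfl fun e _ => ?_
  change ((γ ⟨e, 0⟩ : ℤ) * Γ.len e : ℝ) • _ = ∑ i : Fin (P.n e + 1),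
    ((γ ⟨e, i⟩ : ℤ) * (P.pos e i.succ - P.pos e i.castSucc) : ℝ) • Γ.endClass ℝ (e, false)
  simp only [hc e, ← Finset.sum_smul, ← Finset.mul_sum]
  congr 2
  rw [sum_telescope (P.pos e)]
  rw [P.pos_zero, P.pos_last, sub_zero]

/-- The identification of the intermediate Jacobian of the subdivided model with that of `Γ`. -/
def collapseJH : P.graph.JH10 →+ Γ.JH10 :=
  QuotientAddGroup.map _ _ P.collapse.toAddMonoidHom P.collapse_L10

end Subdivision

/-! ### The Abel–Jacobi map on all divisors -/

section AbelJacobi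

variable {Γ : MetricGraph.{u}}

open scoped Classical in
/-- The positions of the points of the support of `D` on the closed edge `e`, together with the two
ends of `e`. -/
def supportPos (D : Γ.Div) (e : Γ.E) : Finset ℝ :=
  {0, Γ.len e} ∪ ((D.support.preimage (fun t => Sum.inr ⟨e, t⟩)
    (fun _ _ _ _ h => eq_of_heq (Sigma.mk.inj_iff.1 (Sum.inr.inj h)).2)).map
      (Function.Embedding.subtype (fun t : ℝ => t ∈ Set.Ioo 0 (Γ.len e))))

lemma supportPos_card (D : Γ.Div) (e : Γ.E) :
    (supportPos D e).card = ((supportPos D e).card - 2) + 2 := by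
  classical
  have h : ({0, Γ.len e} : Finset ℝ).card ≤ (supportPos D e).card := by
    refine Finset.card_le_card ?_
    rw [supportPos]
    convert Finset.subset_union_left
  rw [Finset.card_pair (Γ.len_pos e).ne] at h
  omega

lemma supportPos_mem (D : Γ.Div) (e : Γ.E) {t : ℝ} (h : t ∈ supportPos D e) :
    0 ≤ t ∧ t ≤ Γ.len e := by
  classical
  have hp := Γ.len_pos e
  simp only [supportPos, Finset.mem_union, Finset.mem_insert, Finset.mem_singleton,
    Finset.mem_map, Function.Embedding.subtype_apply] at h
  rcases h with (rfl | rfl) | ⟨a, -, rfl⟩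
  · exact ⟨le_rfl, hp.le⟩
  · exact ⟨hp.le, le_rfl⟩
  · exact ⟨a.2.1.le, a.2.2.le⟩

/-- The coarsest subdivision such that the support of `D` consists of vertices. -/
def supportSubdivision (D : Γ.Div) : Subdivision Γ where
  n e := (supportPos D e).card - 2
  pos e := (supportPos D e).orderEmbOfFin (supportPos_card D e)
  strictMono e := OrderEmbedding.strictMono _
  pos_zero e := by
    refine (Finset.orderEmbOfFin_zero (supportPos_card D e) (Nat.succ_pos _)).trans ?_
    refine le_antisymm (Finset.min'_le _ _ (by simp [supportPos])) ?_
    exact (supportPos_mem D e (Finset.min'_mem _ _)).1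
  pos_last e := by
    refine (Finset.orderEmbOfFin_last (supportPos_card D e) (Nat.succ_pos _)).trans ?_
    refine le_antisymm ?_ (Finset.le_max' _ _ (by simp [supportPos]))
    exact (supportPos_mem D e (Finset.max'_mem _ _)).2

/-- The divisor `D` is homologically trivial: its cycle class in `H_{0,0}` vanishes. -/
def IsHomTrivial (D : Γ.Div) : Prop :=
  (supportSubdivision D).restrict D ∈ LinearMap.ker (supportSubdivision D).graph.cl

/-- The Abel–Jacobi map `Z_0° → JH_{1,0}(Γ)` on homologically trivial 0-cycles, computed on a
subdivision that contains the support of the cycle among its vertices. -/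
def abelJacobi (D : Γ.Div) (h : IsHomTrivial D) : Γ.JH10 :=
  (supportSubdivision D).collapseJH ((supportSubdivision D).graph.abelJacobiModel ⟨_, h⟩)

end AbelJacobi

end MetricGraph
end

noncomputable section

namespace MetricGraph

/-! ### Generators and relations for `H_{1,0}`; duality with harmonic forms -/

section Homology

variable {Γ : MetricGraph.{u}}

/-! The boundaries in `C_{1,0}` identify the classes of `1_e` at the two ends of `e`. So `H_{1,0}(Γ,
ℝ)` has one generator per edge and one balancing relation per vertex, and a functional on it is a
function on the edges satisfying the vertex condition, that is, a harmonic form. Dualizing gives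
`Ω^∨ = H_{1,0}` (`exists_H10_lift`, `exists_dual_equiv`). The two half-edge terms of `N([e, 1])` add
up to `ℓ(e)` times the class of `1_e`, and this class corresponds to `ω ↦ ω(1_e)`. Hence `N` is
integration already on chains (`monodromyMod_eq_ev`), and the two lattices correspond.

For Abel–Jacobi, let `D = ∂γ` on a subdivision. The function `x ↦ [∫_{η x} ω]` with values in `Jac`
changes along each edge by the integral over that edge, because closed paths integrate to periods
(`Path.integral_sub_mem_periods`). Extended linearly to `∂γ`, it therefore gives `[∫_γ ω]`, whatever
the paths `η` are (`abelJacobiClassical_eq`). Since this works on every subdivision, the tropical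
map is independent of the subdivision: each version equals the classical map. On a connected graph
all vertices have the same class in `H_{0,0}`, so the cycle class is determined by the degree. -/

lemma H10_hom_ext {M : Type*} [AddCommGroup M] [Module ℝ M] {f g : Γ.H10 ℝ →ₗ[ℝ] M}
    (h : ∀ k, f (Γ.endClass ℝ k) = g (Γ.endClass ℝ k)) : f = g := by
  classical
  refine Submodule.linearMap_qext _ (LinearMap.pi_ext' fun v => ?_)
  refine Submodule.linearMap_qext _ (LinearMap.pi_ext' ?_)
  rintro ⟨k, rfl⟩
  refine LinearMap.ext_ring ?_
  have := h k
  simp only [endClass, endChain] at this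
  simp only [LinearMap.comp_apply, LinearMap.coe_single, Submodule.mkQ_apply]
  convert this

open scoped Classical in
-- Translates the balancing relation of `F_1(v)` into the form of the harmonicity condition; a loop
-- at `v` enters both sums and cancels.
lemma sum_sgn_endAt {M : Type u} [AddCommGroup M] [Module ℝ M] (f : Γ.E → M) (v : Γ.V) :
    ∑ h : Γ.EndAt v, (sgn ℝ h.1.2 : ℝ) • f h.1.1 =
      ∑ e with Γ.src e = v, f e - ∑ e with Γ.dst e = v, f e := by
  rw [Subdivision.sum_endAt v fun h => (sgn ℝ h.2 : ℝ) • f h.1, Finset.sum_filter,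
    Finset.sum_filter, ← Finset.sum_sub_distrib]
  refine Finset.sum_congr rfl fun e _ => ?_
  simp only [sgn, if_true, Bool.false_eq_true, if_false, neg_smul, one_smul, eq_comm (a := v)]
  split_ifs <;> simp

open scoped Classical in
/-- The universal property of `H_{1,0}`. -/
lemma exists_H10_lift {M : Type u} [AddCommGroup M] [Module ℝ M] (f : Γ.E → M)
    (hf : ∀ v, ∑ e with Γ.src e = v, f e = ∑ e with Γ.dst e = v, f e) :
    ∃ g : Γ.H10 ℝ →ₗ[ℝ] M, ∀ h, g (Γ.endClass ℝ h) = f h.1 := by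
  let g1 (v : Γ.V) : Γ.F1 ℝ v →ₗ[ℝ] M := Submodule.liftQ _
    (Fintype.linearCombination ℝ fun h : Γ.EndAt v => f h.1.1) (by
      rw [Submodule.span_singleton_le_iff_mem, LinearMap.mem_ker,
        Fintype.linearCombination_apply]
      exact (sum_sgn_endAt f v).trans (sub_eq_zero.2 (hf v)))
  let g2 : Γ.C10 ℝ →ₗ[ℝ] M := ∑ v, g1 v ∘ₗ LinearMap.proj v
  have hg2 : ∀ h, g2 (Γ.endChain ℝ h) = f h.1 := by
    intro h
    simp only [g2, LinearMap.sum_apply, LinearMap.comp_apply, LinearMap.proj_apply]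
    rw [Finset.sum_eq_single (Γ.root h)]
    · rw [endChain, Pi.single_eq_same, Submodule.liftQ_apply,
        Fintype.linearCombination_apply_single, one_smul]
    · intro v _ hv
      rw [endChain, Pi.single_eq_of_ne hv, map_zero]
    · simp
  refine ⟨Submodule.liftQ _ g2 ?_, fun h => hg2 h⟩
  rintro _ ⟨c, rfl⟩
  rw [LinearMap.mem_ker, bdry1, Fintype.linearCombination_apply, map_sum]
  exact Finset.sum_eq_zero fun i _ => by rw [map_smul, map_sub, hg2, hg2, sub_self, smul_zero]

lemma endClass_eq_false (h : Γ.E × Bool) : Γ.endClass ℝ h = Γ.endClass ℝ (h.1, false) := by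
  rcases h with ⟨e, _ | _⟩
  · rfl
  · exact Subdivision.endClass_eq e

open scoped Classical in
-- The edge classes are themselves a balanced family, so applying any functional to them yields a
-- harmonic form.
lemma endClass_balanced (v : Γ.V) :
    ∑ e with Γ.src e = v, Γ.endClass ℝ (e, false) =
      ∑ e with Γ.dst e = v, Γ.endClass ℝ (e, false) := by
  rw [← sub_eq_zero, ← sum_sgn_endAt fun e => Γ.endClass ℝ (e, false)]
  simpa only [endClass_eq_false] using Subdivision.balancing_base v

variable (Γ) in
/-- The canonical identification `H_{1,0}(Γ, ℝ) = Ω^∨`. -/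
theorem exists_dual_equiv : ∃ φ : Module.Dual ℝ Γ.Omega ≃ₗ[ℝ] Γ.H10 ℝ,
    ∀ (e : Γ.E) (s : Bool), φ (Γ.tangent e) = Γ.endClass ℝ (e, s) := by
  classical
  obtain ⟨ψ, hψ⟩ := exists_H10_lift Γ.tangent (fun v => by
    ext ω
    simpa [tangent] using ω.2 v)
  have hinj : Function.Injective ψ := by
    rw [injective_iff_map_eq_zero]
    intro x hx
    rw [← Module.forall_dual_apply_eq_zero_iff ℝ]
    intro f
    -- Every functional `f` on `H_{1,0}` is evaluation at a harmonic form composed with `ψ`. So all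
    -- functionals vanish on the kernel of `ψ`, and functionals separate points.
    let ω : Γ.Omega := ⟨fun e => f (Γ.endClass ℝ (e, false)), fun v => by
      simpa using congrArg f (endClass_balanced v)⟩
    have : Module.Dual.eval ℝ Γ.Omega ω ∘ₗ ψ = f := by
      refine H10_hom_ext fun k => ?_
      rw [LinearMap.comp_apply, hψ, endClass_eq_false]
      rfl
    rw [← this, LinearMap.comp_apply, hx, map_zero]
  have hsurj : Function.Surjective ψ := by
    intro ξ
    -- Extended to all of `ℝ^E`, the functional becomes a combination of coordinates, whose
    -- restrictions to `Ω` are the values of `ψ` on the edge classes.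
    obtain ⟨ξ', rfl⟩ := LinearMap.exists_extend ξ
    refine ⟨∑ e, ξ' (Pi.single e 1) • Γ.endClass ℝ (e, false), ?_⟩
    ext ω
    simp only [map_sum, map_smul, hψ, LinearMap.sum_apply, LinearMap.smul_apply, tangent,
      LinearMap.comp_apply, LinearMap.proj_apply, smul_eq_mul]
    conv_rhs => rw [← Finset.univ_sum_single (Γ.Omega.subtype ω), map_sum]
    refine Finset.sum_congr rfl fun e _ => ?_
    rw [mul_comm, ← smul_eq_mul, ← map_smul, ← Pi.single_smul, smul_eq_mul, mul_one]
  refine ⟨(LinearEquiv.ofBijective ψ ⟨hinj, hsurj⟩).symm, fun e s => ?_⟩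
  rw [LinearEquiv.symm_apply_eq]
  exact (hψ (e, s)).symm

end Homology

/-! ### Integrals along paths, modulo periods -/

section Paths

variable {Γ : MetricGraph.{u}}

lemma ev_apply (γ : Γ.C01 ℝ) : Γ.ev γ = ∑ e, (γ e * Γ.len e) • Γ.tangent e := by
  rw [ev, Fintype.linearCombination_apply]
  simp only [smul_smul]

open scoped Classical in
lemma bdry0_single (R : Type) [CommRing R] (e : Γ.E) (c : R) :
    Γ.bdry0 R (Pi.single e c) = c • (Pi.single (Γ.dst e) 1 - Pi.single (Γ.src e) 1) := by
  rw [bdry0, Fintype.linearCombination_apply_single]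

/-- The source vertex of the edge containing a point. -/
def Point.base : Γ.Point → Γ.V
  | Sum.inl v => v
  | Sum.inr x => Γ.src x.1

/-- Integration of harmonic forms from `x.base` to `x`. -/
def Point.baseIntegral : Γ.Point → Module.Dual ℝ Γ.Omega
  | Sum.inl _ => 0
  | Sum.inr x => x.2.1 • Γ.tangent x.1

open scoped Classical in
/-- `1` if the parameter `t` is that of the far end of the edge, and `0` otherwise. -/
def atEnd {e : Γ.E} (t : Set.Icc (0 : ℝ) (Γ.len e)) : ℤ := if t.1 = Γ.len e then 1 else 0

open scoped Classical in
-- The base of a point of the closed edge `e` is `src e`, except at the far end, where it jumps to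
-- `dst e`; the jump is the boundary of the whole edge.
lemma single_base_pt (e : Γ.E) (t : Set.Icc (0 : ℝ) (Γ.len e)) :
    (Pi.single (Point.base (Γ.pt e t)) 1 : Γ.C00 ℤ) =
      Pi.single (Γ.src e) 1 + Γ.bdry0 ℤ (Pi.single e (atEnd t)) := by
  rw [bdry0_single]
  unfold pt atEnd
  have := (Γ.len_pos e).ne
  split_ifs with h0 h1 <;> simp_all [Point.base]

open scoped Classical in
lemma baseIntegral_pt (e : Γ.E) (t : Set.Icc (0 : ℝ) (Γ.len e)) :
    Point.baseIntegral (Γ.pt e t) =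
      t.1 • Γ.tangent e - Γ.ev (Γ.intC01 (Pi.single e (atEnd t))) := by
  have h : Γ.intC01 (Pi.single e (atEnd t)) = Pi.single e (atEnd t : ℝ) := by
    ext k
    by_cases hk : k = e
    · subst hk; simp [intC01]
    · simp [intC01, hk]
  rw [h, ev, Fintype.linearCombination_apply_single]
  unfold pt atEnd
  have := (Γ.len_pos e).ne
  split_ifs with h0 h1 <;> simp_all [Point.baseIntegral]

open scoped Classical in
/-- Integration along a path is integration over an integral chain between the base vertices of its
end points, up to the integrals from the base vertices to the end points. -/
lemma Path.exists_chain {x y : Γ.Point} (p : Γ.Path x y) : ∃ z : Γ.C01 ℤ,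
    Γ.bdry0 ℤ z = Pi.single (Point.base y) 1 - Pi.single (Point.base x) 1 ∧
    p.integral = Γ.ev (Γ.intC01 z) + Point.baseIntegral y - Point.baseIntegral x := by
  induction p with
  | nil x => exact ⟨0, by simp, by simp [Path.integral]⟩
  | cons e a b p ih =>
    obtain ⟨z, hz, hp⟩ := ih
    -- A move inside `e` changes the base vertex only when it leaves or reaches the far end, so only
    -- these cases contribute a copy of `e`; the rest sits in the `baseIntegral` terms.
    refine ⟨z + (Pi.single e (atEnd b) - Pi.single e (atEnd a)), ?_, ?_⟩
    · rw [map_add, map_sub, hz, single_base_pt, single_base_pt]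
      abel
    · rw [Path.integral, hp, baseIntegral_pt, baseIntegral_pt]
      simp only [map_add, map_sub]
      rw [sub_smul (M := Module.Dual ℝ Γ.Omega) b.1 a.1 (Γ.tangent e)]
      abel

/-- The integral along a closed triangle of paths is a period. -/
lemma Path.integral_sub_mem_periods {x y y' : Γ.Point} (p : Γ.Path x y) (q : Γ.Path x y')
    (r : Γ.Path y y') : q.integral - p.integral - r.integral ∈ Γ.periods := by
  classical
  obtain ⟨zp, hzp, hp⟩ := p.exists_chain
  obtain ⟨zq, hzq, hq⟩ := q.exists_chain
  obtain ⟨zr, hzr, hr⟩ := r.exists_chain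
  refine ⟨⟨zq - zp - zr, ?_⟩, ?_⟩
  · rw [LinearMap.mem_ker, map_sub, map_sub, hzp, hzq, hzr]
    abel
  · change Γ.ev (Γ.intC01 (zq - zp - zr)) = _
    rw [hp, hq, hr]
    simp only [map_sub]
    abel

/-- The one-segment path from `a` to `b` closes the triangle formed with the two chosen paths. This
is where the choice of `η` drops out. -/
lemma mk_integral_pt_sub {x₀ : Γ.Point} (η : ∀ x, Γ.Path x₀ x) (e : Γ.E)
    (a b : Set.Icc (0 : ℝ) (Γ.len e)) :
    (QuotientAddGroup.mk (η (Γ.pt e b)).integral - QuotientAddGroup.mk (η (Γ.pt e a)).integral :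
      Γ.Jac) = QuotientAddGroup.mk ((b.1 - a.1) • Γ.tangent e) := by
  have h := Path.integral_sub_mem_periods (η (Γ.pt e a)) (η (Γ.pt e b))
    (.cons e a b (.nil (Γ.pt e b)))
  simp only [Path.integral, add_zero] at h
  rw [← QuotientAddGroup.mk_sub, ← sub_eq_zero, ← QuotientAddGroup.mk_sub]
  exact (QuotientAddGroup.eq_zero_iff _).2 h

end Paths

/-! ### Invariance of `H_{1,0}` and `JH_{1,0}` under subdivision -/

namespace Subdivision

variable {Γ : MetricGraph.{u}} (P : Subdivision Γ)

lemma vert_eq_inr_iff {e e' : Γ.E} {i : Fin (P.n e)} {j : Fin (P.n e' + 2)} :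
    P.vert e' j = Sum.inr ⟨e, i⟩ ↔ e' = e ∧ j.1 = i.1 + 1 := by
  constructor
  · intro h
    induction j using Fin.cases with
    | zero => simp [vert] at h
    | succ j =>
      induction j using Fin.lastCases with
      | last => rw [Fin.succ_last, vert_last] at h; cases h
      | cast j =>
        rw [vert_inner] at h
        obtain ⟨rfl, hj⟩ := Sigma.mk.inj_iff.1 (Sum.inr.inj h)
        simp [← eq_of_heq hj]
  · rintro ⟨rfl, hj⟩
    have : j = i.castSucc.succ := by ext; simpa using hj
    rw [this, vert_inner]

lemma dst_eq_inr_iff {e : Γ.E} {i : Fin (P.n e)} {k : P.graph.E} :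
    P.graph.dst k = Sum.inr ⟨e, i⟩ ↔ k = (⟨e, i.castSucc⟩ : P.graph.E) := by
  obtain ⟨e', j⟩ := k
  refine (P.vert_eq_inr_iff (i := i) (j := j.succ)).trans ⟨?_, ?_⟩
  · rintro ⟨rfl, hj⟩
    exact congrArg (Sigma.mk e') (Fin.ext (by simpa using hj))
  · intro h
    obtain ⟨rfl, hj⟩ := Sigma.mk.inj_iff.1 h
    simp [eq_of_heq hj]

lemma src_eq_inr_iff {e : Γ.E} {i : Fin (P.n e)} {k : P.graph.E} :
    P.graph.src k = Sum.inr ⟨e, i⟩ ↔ k = (⟨e, i.succ⟩ : P.graph.E) := by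
  obtain ⟨e', j⟩ := k
  refine (P.vert_eq_inr_iff (i := i) (j := j.castSucc)).trans ⟨?_, ?_⟩
  · rintro ⟨rfl, hj⟩
    exact congrArg (Sigma.mk e') (Fin.ext (by simpa using hj))
  · intro h
    obtain ⟨rfl, hj⟩ := Sigma.mk.inj_iff.1 h
    simp [eq_of_heq hj]

/-- The class of the unit tangent vector is the same for all parts of an edge. -/
lemma endClass_graph_eq (e : Γ.E) (i : Fin (P.n e + 1)) :
    P.graph.endClass ℝ ((⟨e, i⟩ : P.graph.E), false) =
      P.graph.endClass ℝ ((⟨e, 0⟩ : P.graph.E), false) := by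
  classical
  induction i using Fin.induction with
  | zero => rfl
  | succ i ih =>
    rw [← ih]
    -- At a new vertex exactly one edge leaves and one arrives, so balancing equates their classes.
    have h := endClass_balanced (Γ := P.graph) (Sum.inr ⟨e, i⟩)
    have key (p : P.graph.E → Prop) (a : P.graph.E) (hp : ∀ k, p k ↔ k = a) :
        ∑ k with p k, P.graph.endClass ℝ (k, false) = P.graph.endClass ℝ (a, false) := by
      rw [show ({k | p k} : Finset P.graph.E) = {a} by ext; simp [hp], Finset.sum_singleton]
    rwa [key _ _ fun k => P.src_eq_inr_iff, key _ _ fun k => P.dst_eq_inr_iff] at h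

open scoped Classical in
/-- The divergence of a function that is constant along the edges of `Γ`. -/
lemma sum_divergence {M : Type*} [AddCommGroup M] (f : Γ.E → M) (w : P.graph.V) :
    ∑ i : P.graph.E, ((if P.graph.dst i = w then f i.1 else 0) -
        if P.graph.src i = w then f i.1 else 0) =
      ∑ e, ((if Sum.inl (Γ.dst e) = w then f e else 0) -
        if Sum.inl (Γ.src e) = w then f e else 0) := by
  refine (Fintype.sum_sigma (ι := Γ.E) (α := fun e => Fin (P.n e + 1)) _).trans
    (Finset.sum_congr rfl fun e _ => ?_)
  -- Along each edge of `Γ` the contributions of the new vertices telescope away.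
  have := sum_telescope fun j : Fin (P.n e + 2) => if P.vert e j = w then f e else 0
  rwa [vert_zero, vert_last] at this

theorem collapse_endClass (h : P.graph.E × Bool) :
    P.collapse (P.graph.endClass ℝ h) = Γ.endClass ℝ (Sigma.fst h.1, false) :=
  P.collapseC10_endChain h

/-- The inverse comes from the universal property: it sends the class of `1_e` to that of the first
piece of `e`. This family is balanced at old vertices because all pieces of an edge have the same
class. -/
theorem collapse_bijective : Function.Bijective P.collapse := by
  classical
  obtain ⟨g, hg⟩ := exists_H10_lift
    (fun e : Γ.E => P.graph.endClass ℝ ((⟨e, 0⟩ : P.graph.E), false)) (fun v => by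
      have h1 := P.sum_divergence
        (fun e : Γ.E => P.graph.endClass ℝ ((⟨e, 0⟩ : P.graph.E), false)) (Sum.inl v)
      have h2 := endClass_balanced (Γ := P.graph) (Sum.inl v)
      rw [Finset.sum_filter, Finset.sum_filter] at h2 ⊢
      rw [Finset.sum_sub_distrib, Finset.sum_sub_distrib] at h1
      simp only [Sum.inl.injEq] at h1
      rw [eq_comm, ← sub_eq_zero, ← h1, sub_eq_zero, eq_comm]
      convert h2 using 3 <;> exact (P.endClass_graph_eq _ _).symm)
  have h1 : g ∘ₗ P.collapse = LinearMap.id := H10_hom_ext fun h => by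
    rw [LinearMap.comp_apply, collapse_endClass, hg, LinearMap.id_apply, endClass_eq_false h]
    exact (P.endClass_graph_eq _ _).symm
  have h2 : P.collapse ∘ₗ g = LinearMap.id := H10_hom_ext fun h => by
    rw [LinearMap.comp_apply, hg, collapse_endClass, LinearMap.id_apply, endClass_eq_false h]
  exact ⟨Function.LeftInverse.injective (g := g) (LinearMap.congr_fun h1),
    Function.RightInverse.surjective (g := g) (LinearMap.congr_fun h2)⟩

/-- The subdivision of an integral cycle. -/
lemma pullback_cycle {γ : Γ.C01 ℤ} (hγ : γ ∈ LinearMap.ker (Γ.bdry0 ℤ)) :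
    (fun i => γ i.1 : P.graph.C01 ℤ) ∈ LinearMap.ker (P.graph.bdry0 ℤ) := by
  classical
  rw [LinearMap.mem_ker] at hγ ⊢
  ext w
  change _ = (0 : ℤ)
  rw [bdry0_apply]
  simp only [mul_sub, mul_ite, mul_one, mul_zero, eq_comm (a := w)]
  rw [P.sum_divergence γ w]
  rcases w with v | x
  · have : Γ.bdry0 ℤ γ v = (0 : ℤ) := congrFun hγ v
    rw [bdry0_apply] at this
    simpa only [mul_sub, mul_ite, mul_one, mul_zero, eq_comm (a := v), Sum.inl.injEq] using this
  · simp

/-- The lengths of the pieces of `e` add up to `ℓ(e)`. With `pullback_cycle`, this shows that every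
element of `L10` of `Γ` comes from the lattice of the subdivision, which gives injectivity on
intermediate Jacobians. -/
lemma collapse_monodromyMod_pullback (γ : Γ.C01 ℤ) :
    P.collapse (P.graph.monodromyMod (P.graph.intC01 fun i => γ i.1)) =
      Γ.monodromyMod (Γ.intC01 γ) := by
  rw [collapse_monodromyMod, monodromyMod_eq, sum_graph]
  refine Finset.sum_congr rfl fun e _ => ?_
  change ∑ i : Fin (P.n e + 1), ((γ e : ℤ) * (P.pos e i.succ - P.pos e i.castSucc) : ℝ) •
    Γ.endClass ℝ (e, false) = ((γ e : ℤ) * Γ.len e : ℝ) • _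
  rw [← Finset.sum_smul, ← Finset.mul_sum, sum_telescope (P.pos e), P.pos_zero, P.pos_last,
    sub_zero]

theorem collapseJH_bijective : Function.Bijective P.collapseJH := by
  constructor
  · rw [injective_iff_map_eq_zero]
    intro x hx
    obtain ⟨x, rfl⟩ := QuotientAddGroup.mk_surjective x
    obtain ⟨⟨γ, hγ⟩, h⟩ : P.collapse x ∈ Γ.L10 := (QuotientAddGroup.eq_zero_iff _).1 hx
    refine (QuotientAddGroup.eq_zero_iff _).2 ⟨⟨_, P.pullback_cycle hγ⟩, ?_⟩
    apply P.collapse_bijective.1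
    exact (P.collapse_monodromyMod_pullback γ).trans h
  · intro y
    obtain ⟨y, rfl⟩ := QuotientAddGroup.mk_surjective y
    obtain ⟨x, rfl⟩ := P.collapse_bijective.2 y
    exact ⟨QuotientAddGroup.mk x, rfl⟩

/-! ### Vertices of a subdivision as points; divisors as 0-chains -/

lemma pos_mem_Icc (e : Γ.E) (j : Fin (P.n e + 2)) : P.pos e j ∈ Set.Icc 0 (Γ.len e) := by
  rw [← P.pos_zero e, ← P.pos_last e]
  exact ⟨(P.strictMono e).monotone (Fin.zero_le _), (P.strictMono e).monotone (Fin.le_last _)⟩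

lemma point_vert (e : Γ.E) (j : Fin (P.n e + 2)) :
    P.point (P.vert e j) = Γ.pt e ⟨P.pos e j, P.pos_mem_Icc e j⟩ := by
  induction j using Fin.cases with
  | zero => simp [pt, P.pos_zero, vert_zero, point]
  | succ j =>
    induction j using Fin.lastCases with
    | last => simp [pt, P.pos_last, vert_last, point, (Γ.len_pos e).ne']
    | cast j =>
      rw [vert_inner]
      have h0 : P.pos e j.castSucc.succ ≠ 0 := by
        rw [← P.pos_zero e]
        exact (P.strictMono e (Fin.succ_pos _)).ne'
      have h1 : P.pos e j.castSucc.succ ≠ Γ.len e := by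
        rw [← P.pos_last e, ← Fin.succ_last]
        exact (P.strictMono e (Fin.succ_lt_succ_iff.2 (Fin.castSucc_lt_last j))).ne
      simp [pt, h0, h1, point]

lemma point_injective : Function.Injective P.point := by
  rintro (v | ⟨e, i⟩) (w | ⟨e', j⟩) h
  · exact congrArg Sum.inl (Sum.inl.inj h)
  · cases h
  · cases h
  · obtain ⟨rfl, h⟩ := Sigma.mk.inj_iff.1 (Sum.inr.inj h)
    have := (P.strictMono e).injective (congrArg Subtype.val (eq_of_heq h))
    simp only [Fin.succ_inj, Fin.castSucc_inj] at this
    rw [this]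

/-- Distinct vertices are distinct points, so sums over the support of `D` become sums over
vertices, the extra ones having coefficient zero. -/
lemma Supports.sum_eq {P : Subdivision Γ} {D : Γ.Div} (hD : P.Supports D) {M : Type*}
    [AddCommGroup M] (A : Γ.Point → M) :
    (D.sum fun x a => a • A x) =
      Fintype.linearCombination ℤ (fun v => A (P.point v)) (P.restrict D) := by
  classical
  rw [Fintype.linearCombination_apply, Finsupp.sum_of_support_subset D
    (s := Finset.univ.image P.point) (fun x hx => by simpa using hD x hx) _ (by simp),
    Finset.sum_image P.point_injective.injOn]
  rfl

end Subdivision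

lemma supports_supportSubdivision {Γ : MetricGraph.{u}} (D : Γ.Div) :
    (supportSubdivision D).Supports D := by
  classical
  rintro (v | ⟨e, t⟩) hx
  · exact ⟨Sum.inl v, rfl⟩
  · have ht : t.1 ∈ supportPos D e := by
      simp only [supportPos, Finset.mem_union, Finset.mem_map]
      exact Or.inr ⟨t, Finset.mem_preimage.2 hx, rfl⟩
    rw [← Finset.mem_coe, ← Finset.range_orderEmbOfFin _ (supportPos_card D e)] at ht
    obtain ⟨j, hj⟩ : ∃ j, (supportSubdivision D).pos e j = t := ht
    refine ⟨(supportSubdivision D).vert e j, ?_⟩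
    rw [Subdivision.point_vert]
    simp [pt, hj, t.2.1.ne', t.2.2.ne]

/-! ### Boundaries and the Abel–Jacobi map of a model -/

section AbelJacobi

variable {Γ : MetricGraph.{u}}

/-- Discrete Stokes formula. Constant `A` shows that boundaries have degree zero; `A` the class of
the integral along `η` computes the classical Abel–Jacobi map. -/
lemma linearCombination_bdry0 {M : Type*} [AddCommGroup M] (A : Γ.V → M) (γ : Γ.C01 ℤ) :
    Fintype.linearCombination ℤ A (Γ.bdry0 ℤ γ) =
      ∑ e, γ e • (A (Γ.dst e) - A (Γ.src e)) := by
  classical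
  have : Fintype.linearCombination ℤ A ∘ₗ Γ.bdry0 ℤ =
      Fintype.linearCombination ℤ fun e => A (Γ.dst e) - A (Γ.src e) := by
    refine LinearMap.pi_ext' fun e => LinearMap.ext_ring ?_
    simp only [LinearMap.comp_apply, LinearMap.coe_single, bdry0_single, one_smul, map_sub,
      Fintype.linearCombination_apply_single]
  rw [← Fintype.linearCombination_apply ℤ, ← this, LinearMap.comp_apply]

lemma abelJacobiModel_eq {α : Γ.V → ℤ} (h : α ∈ LinearMap.ker Γ.cl) {γ : Γ.C01 ℤ}
    (hγ : Γ.bdry0 ℤ γ = α) : Γ.abelJacobiModel ⟨α, h⟩ = Γ.psi γ := by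
  subst hγ
  simp only [abelJacobiModel, AddMonoidHom.comp_apply]
  have : (QuotientAddGroup.quotientKerEquivRange (Γ.bdry0 ℤ).toAddMonoidHom).symm
      ⟨Γ.bdry0 ℤ γ, ⟨γ, rfl⟩⟩ = QuotientAddGroup.mk γ := by
    rw [AddEquiv.symm_apply_eq]
    rfl
  exact congrArg (QuotientAddGroup.lift _ Γ.psi Γ.psi_ker) this

end AbelJacobi

/-! ### Cycle classes and comparison of the Abel–Jacobi maps -/

namespace Subdivision

variable {Γ : MetricGraph.{u}} (P : Subdivision Γ)

open scoped Classical in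
/-- The class of a vertex of the subdivision in `H_{0,0}`. -/
def vertexClass (w : P.graph.V) : P.graph.H00 ℤ := Submodule.Quotient.mk (Pi.single w 1)

lemma vertexClass_vert (e : Γ.E) (j : Fin (P.n e + 2)) :
    P.vertexClass (P.vert e j) = P.vertexClass (Sum.inl (Γ.src e)) := by
  classical
  induction j using Fin.induction with
  | zero => rfl
  | succ j ih =>
    rw [← ih]
    refine (Submodule.Quotient.eq _).2 ⟨Pi.single (⟨e, j⟩ : P.graph.E) 1, ?_⟩
    exact (bdry0_single ℤ _ _).trans (one_smul _ _)

lemma vertexClass_base_pt (e : Γ.E) (t : Set.Icc (0 : ℝ) (Γ.len e)) :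
    P.vertexClass (Sum.inl (Γ.pt e t).base) = P.vertexClass (Sum.inl (Γ.src e)) := by
  unfold pt
  split_ifs
  · rfl
  · have := P.vertexClass_vert e (Fin.last _)
    rwa [vert_last] at this
  · rfl

/-- The path lives on `Γ` and may turn at points that are not vertices of the subdivision, hence the
comparison through base vertices. -/
lemma vertexClass_eq_of_path {x y : Γ.Point} (p : Γ.Path x y) :
    P.vertexClass (Sum.inl x.base) = P.vertexClass (Sum.inl y.base) := by
  induction p with
  | nil x => rfl
  | cons e a b p ih => rw [← ih, vertexClass_base_pt, vertexClass_base_pt]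

lemma vertexClass_eq (hconn : Γ.Connected) (w w' : P.graph.V) :
    P.vertexClass w = P.vertexClass w' := by
  have key : ∀ w : P.graph.V, P.vertexClass w = P.vertexClass (Sum.inl (P.point w).base) := by
    rintro (v | ⟨e, i⟩)
    · rfl
    · have := P.vertexClass_vert e i.castSucc.succ
      rwa [vert_inner] at this
  obtain ⟨p⟩ := hconn.2 (P.point w) (P.point w')
  rw [key w, key w', P.vertexClass_eq_of_path p]

/-- The homologically trivial cycles are the divisors of degree zero. -/
theorem restrict_mem_ker_cl_iff (hconn : Γ.Connected) {D : Γ.Div} (hD : P.Supports D) :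
    P.restrict D ∈ LinearMap.ker P.graph.cl ↔ D ∈ Γ.Div0 := by
  classical
  have hdeg : Γ.degree D =
      Fintype.linearCombination ℤ (fun _ : P.graph.V => (1 : ℤ)) (P.restrict D) := by
    rw [← hD.sum_eq fun _ => (1 : ℤ)]
    simp only [degree, Finsupp.liftAddHom_apply, smul_eq_mul, mul_one]
    rfl
  rw [Div0, AddMonoidHom.mem_ker, hdeg]
  constructor
  · intro h
    obtain ⟨γ, hγ⟩ := P.graph.mem_range_of_cl h
    have hγ' : P.graph.bdry0 ℤ γ = P.restrict D := hγ
    rw [← hγ', linearCombination_bdry0]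
    simp
  · intro h
    obtain ⟨v₀⟩ := hconn.1
    -- All vertex classes equal that of `v₀`, so the cycle class of a 0-chain is its degree times
    -- this one class.
    have h1 : P.graph.cl = Fintype.linearCombination ℤ P.vertexClass := by
      refine LinearMap.pi_ext' fun w => LinearMap.ext_ring ?_
      simp only [LinearMap.comp_apply, LinearMap.coe_single,
        Fintype.linearCombination_apply_single, one_smul]
      rfl
    rw [LinearMap.mem_ker, h1, Fintype.linearCombination_apply]
    simp only [P.vertexClass_eq hconn _ (Sum.inl v₀)]
    rw [Fintype.linearCombination_apply] at h
    simp only [smul_eq_mul, mul_one] at h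
    rw [← Finset.sum_smul, h, zero_smul]

/-- By the Stokes formula only differences of integrals across edges of the subdivision enter, and
these depend on neither `x₀` nor `η`. -/
lemma abelJacobiClassical_eq {x₀ : Γ.Point} (η : ∀ x, Γ.Path x₀ x) (D : Γ.Div0)
    (hD : P.Supports D.1) {γ : P.graph.C01 ℤ} (hγ : P.graph.bdry0 ℤ γ = P.restrict D.1) :
    Γ.abelJacobiClassical η D =
      QuotientAddGroup.mk (∑ i, (γ i * P.graph.len i : ℝ) • Γ.tangent i.1) := by
  have h1 : Γ.abelJacobiClassical η D =
      D.1.sum fun x a => a • (QuotientAddGroup.mk (η x).integral : Γ.Jac) := rfl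
  rw [h1, hD.sum_eq, ← hγ, linearCombination_bdry0]
  refine Eq.trans ?_ (map_sum (QuotientAddGroup.mk' Γ.periods) _ _).symm
  refine Finset.sum_congr rfl fun ⟨e, i⟩ _ => ?_
  have h2 : P.point (P.graph.dst ⟨e, i⟩) = _ := P.point_vert e i.succ
  have h3 : P.point (P.graph.src ⟨e, i⟩) = _ := P.point_vert e i.castSucc
  rw [h2, h3, mk_integral_pt_sub, mul_smul, Int.cast_smul_eq_zsmul]
  rfl

/-- The classical Abel–Jacobi map agrees with the tropical one, computed on any subdivision. -/
theorem abelJacobiClassical_eq_abelJacobiModel {φ : Module.Dual ℝ Γ.Omega ≃ₗ[ℝ] Γ.H10 ℝ}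
    (hφ : ∀ (e : Γ.E) (s : Bool), φ (Γ.tangent e) = Γ.endClass ℝ (e, s)) {Φ : Γ.Jac ≃+ Γ.JH10}
    (hΦ : ∀ ξ : Module.Dual ℝ Γ.Omega, Φ (QuotientAddGroup.mk ξ) = QuotientAddGroup.mk (φ ξ))
    {x₀ : Γ.Point} (η : ∀ x, Γ.Path x₀ x) (D : Γ.Div0) (hD : P.Supports D.1)
    (h : P.restrict D.1 ∈ LinearMap.ker P.graph.cl) :
    Φ (Γ.abelJacobiClassical η D) =
      P.collapseJH (P.graph.abelJacobiModel ⟨P.restrict D.1, h⟩) := by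
  obtain ⟨γ, hγ⟩ := P.graph.mem_range_of_cl h
  rw [abelJacobiModel_eq h hγ, P.abelJacobiClassical_eq η D hD hγ, hΦ]
  change _ = QuotientAddGroup.mk (P.collapse (P.graph.monodromyMod (P.graph.intC01 γ)))
  -- Both sides are now the class of the sum of `γ i * len i` times the class of the unit tangent
  -- vector of the edge of `Γ` containing `i`.
  rw [collapse_monodromyMod]
  simp only [map_sum, map_smul, hφ _ false]
  rfl

end Subdivision

/-! ### Monodromy as integration; the isomorphism of Jacobians -/

section

variable {Γ : MetricGraph.{u}}

/-- No cycle condition is needed: modulo boundaries the contributions `ℓ(e)/2` at the two ends of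
`e` combine to `ℓ(e)` times a single class. -/
lemma monodromyMod_eq_ev {φ : Module.Dual ℝ Γ.Omega ≃ₗ[ℝ] Γ.H10 ℝ}
    (hφ : ∀ (e : Γ.E) (s : Bool), φ (Γ.tangent e) = Γ.endClass ℝ (e, s)) (γ : Γ.C01 ℝ) :
    Γ.monodromyMod γ = φ (Γ.ev γ) := by
  rw [Subdivision.monodromyMod_eq, ev_apply]
  simp only [map_sum, map_smul, hφ _ false]

lemma exists_jacobian_equiv {φ : Module.Dual ℝ Γ.Omega ≃ₗ[ℝ] Γ.H10 ℝ}
    (hφ : ∀ (e : Γ.E) (s : Bool), φ (Γ.tangent e) = Γ.endClass ℝ (e, s)) :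
    ∃ Φ : Γ.Jac ≃+ Γ.JH10, ∀ ξ : Module.Dual ℝ Γ.Omega,
      Φ (QuotientAddGroup.mk ξ) = QuotientAddGroup.mk (φ ξ) := by
  refine ⟨QuotientAddGroup.congr Γ.periods Γ.L10 φ.toAddEquiv ?_, fun ξ => rfl⟩
  rw [periods, AddMonoidHom.map_range, L10]
  congr 1
  ext γ
  exact (monodromyMod_eq_ev hφ _).symm

end

end MetricGraph

end

theorem mainTheorem6 (Γ : MetricGraph.{u}) (hconn : Γ.Connected) (hsep : Γ.NoSeparatingEdges) :
    -- homologically trivial 0-cycles are the divisors of degree zero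
    (∀ D : Γ.Div, MetricGraph.IsHomTrivial D ↔ D ∈ Γ.Div0) ∧
    -- neither the cycle class nor the Abel–Jacobi map depends on the polyhedral structure
    (∀ P : MetricGraph.Subdivision Γ, Function.Bijective P.collapse ∧
      Function.Bijective P.collapseJH ∧
      ∀ D : Γ.Div, P.Supports D →
        (P.restrict D ∈ LinearMap.ker P.graph.cl ↔ MetricGraph.IsHomTrivial D) ∧
        ∀ (h : P.restrict D ∈ LinearMap.ker P.graph.cl) (h' : MetricGraph.IsHomTrivial D),
          P.collapseJH (P.graph.abelJacobiModel ⟨P.restrict D, h⟩) =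
            MetricGraph.abelJacobi D h') ∧
    -- the canonical identification `Ω^∨ = H_{1,0}(Γ, ℝ)`
    ∃ φ : Module.Dual ℝ Γ.Omega ≃ₗ[ℝ] Γ.H10 ℝ,
      (∀ (e : Γ.E) (s : Bool), φ (Γ.tangent e) = Γ.endClass ℝ (e, s)) ∧
      -- monodromy is integration of harmonic forms
      (∀ γ : Γ.H01 ℝ, Γ.monodromy γ = φ (Γ.ev γ)) ∧
      -- the induced isomorphism of Jacobians
      ∃ Φ : Γ.Jac ≃+ Γ.JH10,
        (∀ ξ : Module.Dual ℝ Γ.Omega,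
          Φ (QuotientAddGroup.mk ξ) = QuotientAddGroup.mk (φ ξ)) ∧
        -- it identifies the two Abel–Jacobi maps
        ∀ (x₀ : Γ.Point) (η : ∀ x, Γ.Path x₀ x) (D : Γ.Div0) (h : MetricGraph.IsHomTrivial D.1),
          Φ (Γ.abelJacobiClassical η D) = MetricGraph.abelJacobi D.1 h := by
  obtain ⟨φ, hφ⟩ := Γ.exists_dual_equiv
  obtain ⟨Φ, hΦ⟩ := MetricGraph.exists_jacobian_equiv hφ
  have htriv (D : Γ.Div) : MetricGraph.IsHomTrivial D ↔ D ∈ Γ.Div0 :=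
    MetricGraph.Subdivision.restrict_mem_ker_cl_iff _ hconn
      (MetricGraph.supports_supportSubdivision D)
  have hAJ (x₀ : Γ.Point) (η : ∀ x, Γ.Path x₀ x) (D : Γ.Div0)
      (h : MetricGraph.IsHomTrivial D.1) :
      Φ (Γ.abelJacobiClassical η D) = MetricGraph.abelJacobi D.1 h :=
    MetricGraph.Subdivision.abelJacobiClassical_eq_abelJacobiModel _ hφ hΦ η D
      (MetricGraph.supports_supportSubdivision D.1) h
  refine ⟨htriv, fun P => ⟨P.collapse_bijective, P.collapseJH_bijective, fun D hD =>
    ⟨(P.restrict_mem_ker_cl_iff hconn hD).trans (htriv D).symm, fun h h' => ?_⟩⟩,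
    φ, hφ, fun γ => MetricGraph.monodromyMod_eq_ev hφ γ.1, Φ, hΦ, hAJ⟩
  -- Independence of the subdivision: for one auxiliary choice of paths, both sides are the image
  -- under `Φ` of the classical Abel–Jacobi class.
  obtain ⟨v₀⟩ := hconn.1
  have η (x : Γ.Point) : Γ.Path (Sum.inl v₀) x := (hconn.2 _ x).some
  rw [← hAJ _ η ⟨D, (htriv D).1 h'⟩ h',
    P.abelJacobiClassical_eq_abelJacobiModel hφ hΦ η ⟨D, (htriv D).1 h'⟩ hD h]
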